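/- Let $m,n\ge 0$ be integers, $\sigma\in\mathbb R$, let $W\in\mathbb R^{m\times n}$ be a random matrix with i.i.d. entries $W_{ij}\sim\mathcal N(0,\sigma^2)$, and let $S=WW^\top$. For an integer $k\ge 1$ consider the $2k$ factors (positions) of the product $$\prod_{t=1}^k W_{i_t j_t}W_{i_{t+1}j_t},\qquad i_{k+1}:=i_1,$$ and let $\mathcal M_{2k}$ be the set of perfect matchings of these $2k$ positions. For $M\in\mathcal M_{2k}$ let $a(M)$ be the number of connected components of the graph on the $k$ column labels $\{1,\dots,k\}$ in which the labels $s,t$ of the column indices $j_s,j_t$ of two matched positions are joined, and let $b(M)$ be the number of connected components of the graph on the $k$ row labels $\{1,\dots,k\}$ in which the labels $s,t$ of the row indices $i_s,i_t$ of two matched positions are joined. For integers $a,b\ge 0$ let $C^{(k)}_{a,b}$ be the number of $M\in\mathcal M_{2k}$ with $a(M)=a$ and $b(M)=b$. (1) For every $k\ge1$: $|\mathcal M_{2k}|=(2k-1)!!$, and $C^{(k)}_{a,b}=0$ unless $1\le a\le k$ and $1\le b\le k$. (2) For every $k\ge1$, $\operatorname{tr}(S^k)$ is integrable and $$\mathbb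 E[\operatorname{tr}(S^k)]=\sigma^{2k}\sum_{M\in\mathcal M_{2k}}n^{a(M)}m^{b(M)}=\sigma^{2k}\sum_{a,b=0}^{k}C^{(k)}_{a,b}\,n^a m^b .$$ (3) In particular $\mathbb E[\operatorname{tr}(S)]=\sigma^2nm$ and $\mathbb E[\operatorname{tr}(S^2)]=\sigma^4nm(m+n+1)$. (4) For $1\le k\le 10$ let $C^{(k)}$ be the $k\times k$ matrix whose entry in row $r$ and column $c$ ($1\le r,c\le k$) is $C^{(k)}_{k+1-r,\,c}$, so that its rows correspond to $n^k,\dots,n$ and its columns to $m,\dots,m^k$. Then $$C^{(1)}=\begin{pmatrix}1\end{pmatrix},$$ $$C^{(2)}=\begin{pmatrix}1 & 0\\ 1 & 1\end{pmatrix},$$ $$C^{(3)}=\begin{pmatrix}1 & 0 & 0\\ 3 & 3 & 0\\ 4 & 3 & 1\end{pmatrix},$$ $$C^{(4)}=\begin{pmatrix}1 & 0 & 0 & 0\\ 6 & 6 & 0 & 0\\ 21 & 17 & 6 & 0\\ 20 & 21 & 6 & 1\end{pmatrix},$$ $$C^{(5)}=\begin{pmatrix}1 & 0 & 0 & 0 &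 0\\ 10 & 10 & 0 & 0 & 0\\ 65 & 55 & 20 & 0 & 0\\ 160 & 175 & 55 & 10 & 0\\ 148 & 160 & 65 & 10 & 1\end{pmatrix},$$ $$C^{(6)}=\begin{pmatrix}1 & 0 & 0 & 0 & 0 & 0\\ 15 & 15 & 0 & 0 & 0 & 0\\ 155 & 135 & 50 & 0 & 0 & 0\\ 701 & 787 & 262 & 50 & 0 & 0\\ 1620 & 1827 & 787 & 135 & 15 & 0\\ 1348 & 1620 & 701 & 155 & 15 & 1\end{pmatrix},$$ $$C^{(7)}=\begin{pmatrix}1 & 0 & 0 & 0 & 0 & 0 & 0\\ 21 & 21 & 0 & 0 & 0 & 0 & 0\\ 315 & 280 & 105 & 0 & 0 & 0 & 0\\ 2247 & 2569 & 889 & 175 & 0 & 0 & 0\\ 9324 & 10822 & 4844 & 889 & 105 & 0 & 0\\ 19068 & 23688 & 10822 & 2569 & 280 & 21 & 0\\ 15104 & 19068 & 9324 & 2247 & 315 & 21 & 1\end{pmatrix},$$ $$C^{(8)}=\begin{pmatrix}1 & 0 & 0 & 0 & 0 & 0 & 0 & 0\\ 28 & 28 & 0 & 0 & 0 & 0 &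 0 & 0\\ 574 & 518 & 196 & 0 & 0 & 0 & 0 & 0\\ 5908 & 6846 & 2436 & 490 & 0 & 0 & 0 & 0\\ 38029 & 45070 & 20730 & 3985 & 490 & 0 & 0 & 0\\ 138016 & 175566 & 83280 & 20730 & 2436 & 196 & 0 & 0\\ 264420 & 343904 & 175566 & 45070 & 6846 & 518 & 28 & 0\\ 198144 & 264420 & 138016 & 38029 & 5908 & 574 & 28 & 1\end{pmatrix},$$ $$C^{(9)}=\begin{pmatrix}1 & 0 & 0 & 0 & 0 & 0 & 0 & 0 & 0\\ 36 & 36 & 0 & 0 & 0 & 0 & 0 & 0 & 0\\ 966 & 882 & 336 & 0 & 0 & 0 & 0 & 0 & 0\\ 13524 & 15834 & 5754 & 1176 & 0 & 0 & 0 & 0 & 0\\ 124029 & 149346 & 70104 & 13941 & 1764 & 0 & 0 & 0 & 0\\ 692088 & 896238 & 437070 & 112575 & 13941 & 1176 & 0 & 0 & 0\\ 2325740 & 3092304 & 1628628 & 437070 & 70104 & 5754 & 336 & 0 & 0\\ 4166880 & 5705232 & 3092304 & 896238 & 149346 & 15834 & 882 & 36 & 0\\ 2998656 & 4166880 & 2325740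 & 692088 & 124029 & 13524 & 966 & 36 & 1\end{pmatrix},$$ $$C^{(10)}=\begin{pmatrix}1 & 0 & 0 & 0 & 0 & 0 & 0 & 0 & 0 & 0\\ 45 & 45 & 0 & 0 & 0 & 0 & 0 & 0 & 0 & 0\\ 1530 & 1410 & 540 & 0 & 0 & 0 & 0 & 0 & 0 & 0\\ 27930 & 32970 & 12180 & 2520 & 0 & 0 & 0 & 0 & 0 & 0\\ 344961 & 420600 & 200580 & 40935 & 5292 & 0 & 0 & 0 & 0 & 0\\ 2723469 & 3576413 & 1781680 & 470920 & 60626 & 5292 & 0 & 0 & 0 & 0\\ 13945700 & 18861430 & 10172240 & 2821775 & 470920 & 40935 & 2520 & 0 & 0 & 0\\ 43448940 & 60666700 & 33822740 & 10172240 & 1781680 & 200580 & 12180 & 540 & 0 & 0\\ 74011488 & 105232400 & 60666700 & 18861430 & 3576413 & 420600 & 32970 & 1410 & 45 & 0\\ 51290496 & 74011488 & 43448940 & 13945700 & 2723469 & 344961 & 27930 & 1530 & 45 & 1\end{pmatrix}.$$ -/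

import Mathlib

open MeasureTheory ProbabilityTheory
open scoped Nat

namespace WishartMoments

/-- The `2k` positions of the product `∏ₜ W (iₜ, jₜ) * W (iₜ₊₁, jₜ)`: the position `(t, false)` is the
factor `W (iₜ, jₜ)` and the position `(t, true)` is the factor `W (iₜ₊₁, jₜ)`. -/
abbrev Position (k : ℕ) : Type := Fin k × Bool

/-- The label `t` of the column index `jₜ` of the factor at a position. -/
def colLabel {k : ℕ} (p : Position k) : Fin k := p.1

/-- The label `s` of the row index `iₛ` of the factor at a position; labels are cyclic, the successor
of the last label being the first one (`finRotate`). -/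
def rowLabel {k : ℕ} (p : Position k) : Fin k := if p.2 then finRotate k p.1 else p.1

/-- Subgraphs of the complete graph on the `2k` positions. -/
abbrev PositionGraph (k : ℕ) : Type := (⊤ : SimpleGraph (Position k)).Subgraph

/-- The finite set of all perfect matchings of the `2k` positions. -/
noncomputable def perfectMatchings (k : ℕ) : Finset (PositionGraph k) :=
  (Set.toFinite {M : PositionGraph k | M.IsPerfectMatching}).toFinset

/-- The graph on the `k` labels with an edge between `label p` and `label q`, when these differ, for
every pair `p`, `q` of positions matched by `M`. -/
def inducedGraph {k : ℕ} (label : Position k → Fin k) (M : PositionGraph k) : SimpleGraph (Fin k) :=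
  SimpleGraph.fromRel fun s t => ∃ p q, M.Adj p q ∧ label p = s ∧ label q = t

/-- The number of connected components that `M` induces on the column indices. -/
noncomputable def colComponents {k : ℕ} (M : PositionGraph k) : ℕ :=
  Nat.card (inducedGraph colLabel M).ConnectedComponent

/-- The number of connected components that `M` induces on the row indices. -/
noncomputable def rowComponents {k : ℕ} (M : PositionGraph k) : ℕ :=
  Nat.card (inducedGraph rowLabel M).ConnectedComponent

/-- The coefficient `C^{(k)}_{a,b}`: the number of perfect matchings that have `a` column components
and `b` row components. -/
noncomputable def coeff (k a b : ℕ) : ℕ :=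
  {M ∈ perfectMatchings k | colComponents M = a ∧ rowComponents M = b}.card

/-- The coefficients arranged along the powers `n^k, …, n` (rows) and `m, …, m^k` (columns). -/
noncomputable def coeffMatrix (k : ℕ) : Matrix (Fin k) (Fin k) ℕ :=
  Matrix.of fun r c => coeff k (k - r) (c + 1)

/-- The random matrix `S = W₀ W₀ᵀ`, where `W₀` has the entries `W i j`. -/
def wishart {Ω : Type*} {m n : ℕ} (W : Fin m → Fin n → Ω → ℝ) (ω : Ω) : Matrix (Fin m) (Fin m) ℝ :=
  Matrix.of (fun i j => W i j ω) * (Matrix.of (fun i j => W i j ω)).transpose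

/-- The tabulated coefficients for `k = 1`. -/
def table1 : Matrix (Fin 1) (Fin 1) ℕ :=
  !![1]

/-- The tabulated coefficients for `k = 2`. -/
def table2 : Matrix (Fin 2) (Fin 2) ℕ :=
  !![1, 0;
     1, 1]

/-- The tabulated coefficients for `k = 3`. -/
def table3 : Matrix (Fin 3) (Fin 3) ℕ :=
  !![1, 0, 0;
     3, 3, 0;
     4, 3, 1]

/-- The tabulated coefficients for `k = 4`. -/
def table4 : Matrix (Fin 4) (Fin 4) ℕ :=
  !![1, 0, 0, 0;
     6, 6, 0, 0;
     21, 17, 6, 0;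
     20, 21, 6, 1]

/-- The tabulated coefficients for `k = 5`. -/
def table5 : Matrix (Fin 5) (Fin 5) ℕ :=
  !![1, 0, 0, 0, 0;
     10, 10, 0, 0, 0;
     65, 55, 20, 0, 0;
     160, 175, 55, 10, 0;
     148, 160, 65, 10, 1]

/-- The tabulated coefficients for `k = 6`. -/
def table6 : Matrix (Fin 6) (Fin 6) ℕ :=
  !![1, 0, 0, 0, 0, 0;
     15, 15, 0, 0, 0, 0;
     155, 135, 50, 0, 0, 0;
     701, 787, 262, 50, 0, 0;
     1620, 1827, 787, 135, 15, 0;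
     1348, 1620, 701, 155, 15, 1]

/-- The tabulated coefficients for `k = 7`. -/
def table7 : Matrix (Fin 7) (Fin 7) ℕ :=
  !![1, 0, 0, 0, 0, 0, 0;
     21, 21, 0, 0, 0, 0, 0;
     315, 280, 105, 0, 0, 0, 0;
     2247, 2569, 889, 175, 0, 0, 0;
     9324, 10822, 4844, 889, 105, 0, 0;
     19068, 23688, 10822, 2569, 280, 21, 0;
     15104, 19068, 9324, 2247, 315, 21, 1]

/-- The tabulated coefficients for `k = 8`. -/
def table8 : Matrix (Fin 8) (Fin 8) ℕ :=
  !![1, 0, 0, 0, 0, 0, 0, 0;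
     28, 28, 0, 0, 0, 0, 0, 0;
     574, 518, 196, 0, 0, 0, 0, 0;
     5908, 6846, 2436, 490, 0, 0, 0, 0;
     38029, 45070, 20730, 3985, 490, 0, 0, 0;
     138016, 175566, 83280, 20730, 2436, 196, 0, 0;
     264420, 343904, 175566, 45070, 6846, 518, 28, 0;
     198144, 264420, 138016, 38029, 5908, 574, 28, 1]

/-- The tabulated coefficients for `k = 9`. -/
def table9 : Matrix (Fin 9) (Fin 9) ℕ :=
  !![1, 0, 0, 0, 0, 0, 0, 0, 0;
     36, 36, 0, 0, 0, 0, 0, 0, 0;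
     966, 882, 336, 0, 0, 0, 0, 0, 0;
     13524, 15834, 5754, 1176, 0, 0, 0, 0, 0;
     124029, 149346, 70104, 13941, 1764, 0, 0, 0, 0;
     692088, 896238, 437070, 112575, 13941, 1176, 0, 0, 0;
     2325740, 3092304, 1628628, 437070, 70104, 5754, 336, 0, 0;
     4166880, 5705232, 3092304, 896238, 149346, 15834, 882, 36, 0;
     2998656, 4166880, 2325740, 692088, 124029, 13524, 966, 36, 1]

/-- The tabulated coefficients for `k = 10`. -/
def table10 : Matrix (Fin 10) (Fin 10) ℕ :=
  !![1, 0, 0, 0, 0, 0, 0, 0, 0, 0;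
     45, 45, 0, 0, 0, 0, 0, 0, 0, 0;
     1530, 1410, 540, 0, 0, 0, 0, 0, 0, 0;
     27930, 32970, 12180, 2520, 0, 0, 0, 0, 0, 0;
     344961, 420600, 200580, 40935, 5292, 0, 0, 0, 0, 0;
     2723469, 3576413, 1781680, 470920, 60626, 5292, 0, 0, 0, 0;
     13945700, 18861430, 10172240, 2821775, 470920, 40935, 2520, 0, 0, 0;
     43448940, 60666700, 33822740, 10172240, 1781680, 200580, 12180, 540, 0, 0;
     74011488, 105232400, 60666700, 18861430, 3576413, 420600, 32970, 1410, 45, 0;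
     51290496, 74011488, 43448940, 13945700, 2723469, 344961, 27930, 1530, 45, 1]

end WishartMoments

/-! # Moments of real Wishart matrices as sums over perfect matchings -/

namespace WishartMoments

/-! ### The Gaussian functional on polynomials -/

section Functional

variable {R : Type*} [CommSemiring R] {ι : Type*} [Fintype ι]

/-! Everything passes through one linear functional on polynomials in the matrix entries. It sends a
monomial to its Gaussian moment and is defined purely algebraically over any commutative semiring.
Over `ℝ` with `v = σ ^ 2` it is the expectation. Over `ℕ` with `v = 1` it counts matchings.

Its only essential property is integration by parts. Applied to a product of variables it gives
Wick's formula (`gaussFunctional_prod_X`): the moment is `v ^ k` times the number of pairings that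
match equal variables. Expand `tr (S ^ k)` over index sequences and interchange the sums. A fixed
matching then forces the row and the column indices to be constant on components, independently of
each other, so it contributes `n ^ a * m ^ b` (`gaussFunctional_trace_pow`).

For the tables, enumerating up to `19‼` matchings is avoided. Integration by parts applied to
products of traces gives a loop equation (`gaussFunctional_expand`) that rewrites a product of power
sums into products of total degree one less. For numerical `m` and `n`, `k` rounds reduce `tr (S ^
k)` to a natural number. Taking `n = B` and `m = B ^ 10` with `B` larger than every coefficient
(Kronecker substitution), the base-`B` digits of this single number are all the coefficients, so one
evaluation proves a whole table. -/

/-- The moments of a centred Gaussian variable of variance `v`. -/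
def gaussMoment (v : R) : ℕ → R
  | 0 => 1
  | 1 => 0
  | k + 2 => (k + 1) * v * gaussMoment v k

theorem gaussMoment_succ (v : R) (k : ℕ) :
    gaussMoment v (k + 1) = k * v * gaussMoment v (k - 1) := by
  cases k with
  | zero => simp [gaussMoment]
  | succ k => simp [gaussMoment]

/-- The linear functional on polynomials that sends a monomial to its moment under independent centred
Gaussian variables of variance `v`. -/
noncomputable def gaussFunctional (v : R) : MvPolynomial ι R →ₗ[R] R :=
  (MvPolynomial.basisMonomials ι R).constr R fun e => ∏ i, gaussMoment v (e i)

theorem gaussFunctional_monomial (v : R) (e : ι →₀ ℕ) (c : R) :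
    gaussFunctional v (MvPolynomial.monomial e c) = c * ∏ i, gaussMoment v (e i) := by
  have h : MvPolynomial.monomial e c = c • MvPolynomial.basisMonomials ι R e := by
    simp [MvPolynomial.smul_monomial]
  rw [h, map_smul, gaussFunctional, Module.Basis.constr_basis, smul_eq_mul]

theorem gaussFunctional_one (v : R) : gaussFunctional v (1 : MvPolynomial ι R) = 1 := by
  rw [← MvPolynomial.C_1, ← MvPolynomial.monomial_zero', gaussFunctional_monomial]
  simp [gaussMoment]

theorem gaussFunctional_C_mul (v c : R) (P : MvPolynomial ι R) :
    gaussFunctional v (MvPolynomial.C c * P) = c * gaussFunctional v P := by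
  rw [← MvPolynomial.smul_eq_C_mul, map_smul, smul_eq_mul]

theorem gaussFunctional_natCast_mul (v : R) (c : ℕ) (P : MvPolynomial ι R) :
    gaussFunctional v ((c : MvPolynomial ι R) * P) = c * gaussFunctional v P := by
  rw [← gaussFunctional_C_mul, map_natCast]

/-- Gaussian integration by parts. -/
theorem gaussFunctional_X_mul (v : R) (i : ι) (P : MvPolynomial ι R) :
    gaussFunctional v (MvPolynomial.X i * P) =
      v * gaussFunctional v (MvPolynomial.pderiv i P) := by
  classical
  induction P using MvPolynomial.induction_on' with
  | monomial e c =>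
    rw [MvPolynomial.X, MvPolynomial.monomial_mul, MvPolynomial.pderiv_monomial,
      gaussFunctional_monomial, gaussFunctional_monomial,
      ← Finset.mul_prod_erase _ _ (Finset.mem_univ i),
      ← Finset.mul_prod_erase _ _ (Finset.mem_univ i)]
    have h1 : ∀ j ∈ Finset.univ.erase i, gaussMoment v ((Finsupp.single i 1 + e : ι →₀ ℕ) j) =
        gaussMoment v ((e - Finsupp.single i 1 : ι →₀ ℕ) j) := by
      intro j hj
      have hj : i ≠ j := (Finset.ne_of_mem_erase hj).symm
      simp [hj]
    rw [Finset.prod_congr rfl h1]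
    simp only [Finsupp.add_apply, Finsupp.single_eq_same, Finsupp.tsub_apply]
    rw [add_comm 1 (e i), gaussMoment_succ]
    ring
  | add P Q hP hQ => simp only [mul_add, map_add, hP, hQ]

end Functional

/-! ### Moments of independent Gaussian variables -/

open NNReal in
-- The moment generating function `M t = exp (v * t ^ 2 / 2)` satisfies `M' = v * t * M`.
-- Differentiating this `k` times and setting `t = 0` gives the recursion, since the derivatives of
-- `M` at `0` are the moments.
theorem integral_pow_succ_gaussianReal (v : ℝ≥0) (k : ℕ) :
    ∫ x, x ^ (k + 1) ∂gaussianReal 0 v = k * v * ∫ x, x ^ (k - 1) ∂gaussianReal 0 v := by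
  have hint : ∀ t, t ∈ interior (integrableExpSet id (gaussianReal 0 v)) := by
    intro t; simp [integrableExpSet_id_gaussianReal]
  have hM : ∀ k t, HasDerivAt (iteratedDeriv k (mgf id (gaussianReal 0 v)))
      (iteratedDeriv (k + 1) (mgf id (gaussianReal 0 v)) t) t := by
    intro k t
    rw [iteratedDeriv_mgf (hint t)]
    exact hasDerivAt_iteratedDeriv_mgf (hint t) k
  have key : ∀ k t, iteratedDeriv (k + 1) (mgf id (gaussianReal 0 v)) t =
      v * (t * iteratedDeriv k (mgf id (gaussianReal 0 v)) t +
        k * iteratedDeriv (k - 1) (mgf id (gaussianReal 0 v)) t) := by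
    intro k
    induction k with
    | zero =>
      intro t
      rw [zero_add, iteratedDeriv_one, iteratedDeriv_zero, mgf_id_gaussianReal]
      have : HasDerivAt (fun t : ℝ => Real.exp (0 * t + v * t ^ 2 / 2))
          (Real.exp (0 * t + v * t ^ 2 / 2) * (0 * 1 + v * (2 * t) / 2)) t := by
        refine HasDerivAt.exp (((hasDerivAt_id t).const_mul 0).add
          (((?_ : HasDerivAt (fun t : ℝ => t ^ 2) (2 * t) t).const_mul (v : ℝ)).div_const 2))
        simpa using hasDerivAt_pow 2 t
      rw [this.deriv]
      simp
      ring
    | succ k ih =>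
      intro t
      have h2 : HasDerivAt (iteratedDeriv (k + 1) (mgf id (gaussianReal 0 v)))
          (v * ((1 * iteratedDeriv k (mgf id (gaussianReal 0 v)) t +
            t * iteratedDeriv (k + 1) (mgf id (gaussianReal 0 v)) t) +
            k * iteratedDeriv (k - 1 + 1) (mgf id (gaussianReal 0 v)) t)) t := by
        have h3 := (((hasDerivAt_id t).mul (hM k t)).add
          ((hM (k - 1) t).const_mul (k : ℝ))).const_mul (v : ℝ)
        exact h3.congr_of_eventuallyEq (Filter.Eventually.of_forall ih)
      rw [(hM (k + 1) t).unique h2]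
      -- For `k = 0` the truncated `k - 1 + 1` is not `k`, but that term carries the factor `k`.
      rcases k with _ | k
      · simp only [zero_add, Nat.cast_zero, Nat.cast_one]; ring
      · simp only [Nat.add_sub_cancel]; push_cast; ring
  have := key k 0
  simp only [iteratedDeriv_mgf_zero (hint 0)] at this
  simp only [Pi.pow_apply, id] at this
  rw [this]
  ring

open NNReal in
theorem integral_pow_gaussianReal (v : ℝ≥0) (k : ℕ) :
    ∫ x, x ^ k ∂gaussianReal 0 v = gaussMoment (v : ℝ) k := by
  induction k using Nat.strong_induction_on with
  | _ k ih =>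
    rcases k with _ | k
    · simp [gaussMoment]
    · rcases k with _ | k
      · rw [integral_pow_succ_gaussianReal, gaussMoment_succ]; simp
      · rw [integral_pow_succ_gaussianReal, gaussMoment_succ, ih _ (by omega)]

open NNReal in
theorem integrable_pow_gaussianReal (v : ℝ≥0) (k : ℕ) :
    Integrable (fun x : ℝ => x ^ k) (gaussianReal 0 v) :=
  integrable_pow_of_mem_interior_integrableExpSet (X := id)
    (by simp [integrableExpSet_id_gaussianReal]) k

open NNReal in
theorem integral_eval_pi_gaussianReal {ι : Type*} [Fintype ι] (v : ℝ≥0) (P : MvPolynomial ι ℝ) :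
    Integrable (fun x : ι → ℝ => MvPolynomial.eval x P) (Measure.pi fun _ => gaussianReal 0 v) ∧
    ∫ x : ι → ℝ, MvPolynomial.eval x P ∂(Measure.pi fun _ => gaussianReal 0 v) =
      gaussFunctional (v : ℝ) P := by
  induction P using MvPolynomial.induction_on' with
  | monomial e c =>
    have h : ∀ x : ι → ℝ, MvPolynomial.eval x (MvPolynomial.monomial e c) = c * ∏ i, x i ^ e i := by
      intro x
      rw [MvPolynomial.eval_monomial, Finsupp.prod_fintype _ _ (by simp)]
    simp only [h]
    refine ⟨(Integrable.fintype_prod fun i => integrable_pow_gaussianReal v (e i)).const_mul c, ?_⟩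
    rw [integral_const_mul, integral_fintype_prod_eq_prod (fun i (x : ℝ) => x ^ e i),
      gaussFunctional_monomial]
    simp only [integral_pow_gaussianReal]
  | add P Q hP hQ =>
    simp only [map_add]
    exact ⟨hP.1.add hQ.1, by rw [integral_add hP.1 hQ.1, hP.2, hQ.2]⟩

open NNReal in
-- Independence makes the joint law a product measure, so the statement transfers from that measure.
theorem integral_eval_of_hasLaw {ι Ω : Type*} [Fintype ι] [MeasurableSpace Ω] {μ : Measure Ω}
    [IsProbabilityMeasure μ] {v : ℝ≥0} {Z : ι → Ω → ℝ} (hind : iIndepFun Z μ)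
    (hlaw : ∀ i, HasLaw (Z i) (gaussianReal 0 v) μ) (P : MvPolynomial ι ℝ) :
    Integrable (fun ω => MvPolynomial.eval (fun i => Z i ω) P) μ ∧
    ∫ ω, MvPolynomial.eval (fun i => Z i ω) P ∂μ = gaussFunctional (v : ℝ) P := by
  have hZ : ∀ i, AEMeasurable (Z i) μ := fun i => (hlaw i).aemeasurable
  have hmap : μ.map (fun ω i => Z i ω) = Measure.pi fun _ => gaussianReal 0 v := by
    rw [(iIndepFun_iff_map_fun_eq_pi_map hZ).1 hind]
    simp only [fun i => (hlaw i).map_eq]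
  have hm : AEMeasurable (fun ω i => Z i ω) μ := aemeasurable_pi_lambda _ hZ
  obtain ⟨h1, h2⟩ := integral_eval_pi_gaussianReal v P
  rw [← hmap] at h1 h2
  refine ⟨h1.comp_aemeasurable hm, ?_⟩
  rw [← h2, integral_map hm h1.aestronglyMeasurable]

/-! ### Pairings and Wick's formula -/

section Pairings

variable {P : Type*} [DecidableEq P]

theorem card_erase_erase {s : Finset P} {k : ℕ} (hs : s.card = 2 * (k + 1)) {x y : P} (hx : x ∈ s)
    (hy : y ∈ s.erase x) : ((s.erase x).erase y).card = 2 * k := by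
  rw [Finset.card_erase_of_mem hy, Finset.card_erase_of_mem hx, hs]
  omega

variable {κ : Type*} [DecidableEq κ]

theorem pderiv_prod_X {R : Type*} [CommSemiring R] (i : κ) (f : P → κ) (s : Finset P) :
    MvPolynomial.pderiv i (∏ y ∈ s, (MvPolynomial.X (f y) : MvPolynomial κ R)) =
      ∑ y ∈ s, if i = f y then ∏ z ∈ s.erase y, MvPolynomial.X (f z) else 0 := by
  induction s using Finset.induction_on with
  | empty => simp
  | insert a s ha ih =>
    rw [Finset.prod_insert ha, MvPolynomial.pderiv_mul, ih, Finset.sum_insert ha,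
      Finset.erase_insert ha, MvPolynomial.pderiv_X, Finset.mul_sum]
    congr 1
    · by_cases h : i = f a
      · rw [if_pos h, ← h, Pi.single_eq_same, one_mul]
      · rw [if_neg h, Pi.single_eq_of_ne (Ne.symm h), zero_mul]
    · refine Finset.sum_congr rfl fun y hy => ?_
      have hay : a ≠ y := by rintro rfl; exact ha hy
      rw [mul_ite, mul_zero, Finset.erase_insert_of_ne hay,
        Finset.prod_insert fun h => ha (Finset.mem_of_mem_erase h)]

variable [Fintype P]

/-- The involutions with support `s` that preserve the labelling `f`. -/
def pairings (s : Finset P) (f : P → κ) : Finset (Equiv.Perm P) :=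
  {g | (∀ x, g (g x) = x) ∧ (∀ x, g x ≠ x ↔ x ∈ s) ∧ ∀ x, f (g x) = f x}

theorem mem_pairings {s : Finset P} {f : P → κ} {g : Equiv.Perm P} :
    g ∈ pairings s f ↔ (∀ x, g (g x) = x) ∧ (∀ x, g x ≠ x ↔ x ∈ s) ∧ ∀ x, f (g x) = f x := by
  simp [pairings]

theorem pairings_empty (f : P → κ) : pairings ∅ f = {1} := by
  ext g
  simp only [mem_pairings, Finset.notMem_empty, iff_false, not_not, Finset.mem_singleton]
  constructor
  · exact fun h => Equiv.ext h.2.1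
  · rintro rfl
    simp

/-- Multiplication by `Equiv.swap x y` deletes the 2-cycle `(x y)` from an involution, and restores
it. This is a bijection with the pairings of the remaining points; it respects the labelling exactly
when `f x = f y`. -/
theorem card_pairings_fiber {s : Finset P} (f : P → κ) {x y : P} (hx : x ∈ s) (hy : y ∈ s.erase x) :
    {g ∈ pairings s f | g x = y}.card =
      if f x = f y then (pairings ((s.erase x).erase y) f).card else 0 := by
  have hyx : y ≠ x := Finset.ne_of_mem_erase hy
  have hys : y ∈ s := Finset.mem_of_mem_erase hy
  split_ifs with hf
  · refine Finset.card_bij' (fun g _ => Equiv.swap x y * g) (fun g _ => Equiv.swap x y * g) ?_ ?_ ?_ ?_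
    · intro g hg
      simp only [Finset.mem_filter, mem_pairings] at hg ⊢
      obtain ⟨⟨h1, h2, h3⟩, h4⟩ := hg
      have h5 : g y = x := by rw [← h4, h1]
      have hz : ∀ z, z ≠ x → z ≠ y → (Equiv.swap x y) (g z) = g z := by
        intro z hzx hzy
        apply Equiv.swap_apply_of_ne_of_ne
        · intro h; apply hzy; rw [← h1 z, h, h4]
        · intro h; apply hzx; rw [← h1 z, h, h5]
      have hx' : (Equiv.swap x y) (g x) = x := by rw [h4, Equiv.swap_apply_right]
      have hy' : (Equiv.swap x y) (g y) = y := by rw [h5, Equiv.swap_apply_left]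
      simp only [Equiv.Perm.mul_apply, Finset.mem_erase]
      refine ⟨fun z => ?_, fun z => ?_, fun z => ?_⟩
      · by_cases hzx : z = x
        · subst hzx; rw [hx', hx']
        by_cases hzy : z = y
        · subst hzy; rw [hy', hy']
        rw [hz z hzx hzy, h1, Equiv.swap_apply_of_ne_of_ne hzx hzy]
      · by_cases hzx : z = x
        · subst hzx; simp [hx']
        by_cases hzy : z = y
        · subst hzy; simp [hy']
        rw [hz z hzx hzy, h2]
        simp [hzx, hzy]
      · by_cases hzx : z = x
        · subst hzx; rw [hx']
        by_cases hzy : z = y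
        · subst hzy; rw [hy']
        rw [hz z hzx hzy, h3]
    · intro g hg
      simp only [Finset.mem_filter, mem_pairings, Finset.mem_erase] at hg ⊢
      obtain ⟨h1, h2, h3⟩ := hg
      have h4 : g x = x := by
        by_contra h; simpa using (h2 x).1 h
      have h5 : g y = y := by
        by_contra h; simpa using (h2 y).1 h
      have hz : ∀ z, z ≠ x → z ≠ y → (Equiv.swap x y) (g z) = g z := by
        intro z hzx hzy
        apply Equiv.swap_apply_of_ne_of_ne
        · intro h; apply hzx; rw [← h1 z, h, h4]
        · intro h; apply hzy; rw [← h1 z, h, h5]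
      have hx' : (Equiv.swap x y) (g x) = y := by rw [h4, Equiv.swap_apply_left]
      have hy' : (Equiv.swap x y) (g y) = x := by rw [h5, Equiv.swap_apply_right]
      simp only [Equiv.Perm.mul_apply]
      refine ⟨⟨fun z => ?_, fun z => ?_, fun z => ?_⟩, hx'⟩
      · by_cases hzx : z = x
        · subst hzx; rw [hx', hy']
        by_cases hzy : z = y
        · subst hzy; rw [hy', hx']
        rw [hz z hzx hzy, h1, Equiv.swap_apply_of_ne_of_ne hzx hzy]
      · by_cases hzx : z = x
        · subst hzx; simp [hx', hyx, hx]
        by_cases hzy : z = y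
        · subst hzy; simp [hy', hyx.symm, hys]
        rw [hz z hzx hzy, h2]
        simp [hzx, hzy]
      · by_cases hzx : z = x
        · subst hzx; rw [hx', hf]
        by_cases hzy : z = y
        · subst hzy; rw [hy', hf]
        rw [hz z hzx hzy, h3]
    · intro g _; simp [← mul_assoc]
    · intro g _; simp [← mul_assoc]
  · rw [Finset.card_eq_zero, Finset.filter_eq_empty_iff]
    rintro g hg rfl
    exact hf ((mem_pairings.1 hg).2.2 x).symm

/-- Classify pairings by the partner of `x`. This is the same recursion that integration by parts
produces on the Gaussian side. -/
theorem card_pairings_eq_sum {s : Finset P} (f : P → κ) {x : P} (hx : x ∈ s) :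
    (pairings s f).card =
      ∑ y ∈ s.erase x, if f x = f y then (pairings ((s.erase x).erase y) f).card else 0 := by
  rw [Finset.card_eq_sum_card_fiberwise (f := fun g => g x) (t := s.erase x)]
  · exact Finset.sum_congr rfl fun y hy => card_pairings_fiber f hx hy
  · intro g hg
    obtain ⟨h1, h2, -⟩ := mem_pairings.1 hg
    have h3 : g x ≠ x := (h2 x).2 hx
    refine Finset.mem_coe.2 (Finset.mem_erase.2 ⟨h3, (h2 _).1 ?_⟩)
    rw [h1]
    exact h3.symm

theorem card_pairings_const (k : ℕ) (s : Finset P) (c : κ) (hs : s.card = 2 * k) :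
    (pairings s fun _ => c).card = (2 * k - 1)‼ := by
  induction k generalizing s with
  | zero => simp [Finset.card_eq_zero.1 hs, pairings_empty]
  | succ k ih =>
    obtain ⟨x, hx⟩ : s.Nonempty := by rw [← Finset.card_pos]; omega
    rw [card_pairings_eq_sum _ hx,
      Finset.sum_congr rfl fun y hy => by rw [if_pos rfl, ih _ (card_erase_erase hs hx hy)],
      Finset.sum_const, Finset.card_erase_of_mem hx, hs, smul_eq_mul]
    -- The case `k = 0` is separate because `2 * 0 - 1` truncates to `0`, where the two-step
    -- recursion of `‼` does not apply.
    rcases k with _ | k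
    · simp
    · rw [show 2 * (k + 1 + 1) - 1 = 2 * k + 1 + 2 by omega, show 2 * (k + 1) - 1 = 2 * k + 1 by omega,
        Nat.doubleFactorial_add_two]

/-- **Wick's formula**. -/
theorem gaussFunctional_prod_X {R : Type*} [CommSemiring R] [Fintype κ] (v : R) (f : P → κ) (k : ℕ)
    (s : Finset P) (hs : s.card = 2 * k) :
    gaussFunctional v (∏ x ∈ s, (MvPolynomial.X (f x) : MvPolynomial κ R)) =
      v ^ k * ((pairings s f).card : R) := by
  induction k generalizing s with
  | zero => simp [Finset.card_eq_zero.1 hs, pairings_empty, gaussFunctional_one]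
  | succ k ih =>
    obtain ⟨x, hx⟩ : s.Nonempty := by rw [← Finset.card_pos]; omega
    rw [← Finset.mul_prod_erase s _ hx, gaussFunctional_X_mul, pderiv_prod_X,
      card_pairings_eq_sum _ hx, map_sum, Nat.cast_sum, Finset.mul_sum, Finset.mul_sum]
    refine Finset.sum_congr rfl fun y hy => ?_
    split_ifs
    · rw [ih _ (card_erase_erase hs hx hy)]
      ring
    · simp

end Pairings

/-! ### Perfect matchings as pairings -/

theorem mem_perfectMatchings {k : ℕ} {M : PositionGraph k} :
    M ∈ perfectMatchings k ↔ ∀ p, ∃! q, M.Adj p q := by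
  simp [perfectMatchings, SimpleGraph.Subgraph.isPerfectMatching_iff]

/-- The perfect matching that joins each position to its image under an involution. -/
def matchingOfPerm {k : ℕ} (g : Equiv.Perm (Position k)) (h1 : ∀ x, g (g x) = x)
    (h2 : ∀ x, g x ≠ x) : PositionGraph k where
  verts := Set.univ
  Adj p q := g p = q
  adj_sub {p q} h := by
    rw [SimpleGraph.top_adj, ← h]
    exact (h2 p).symm
  edge_vert _ := Set.mem_univ _
  symm := ⟨fun p q h => by rw [← h, h1]⟩

theorem exists_pairing_of_perfectMatching {k : ℕ} {M : PositionGraph k} (hM : M ∈ perfectMatchings k) :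
    ∃ g : Equiv.Perm (Position k), (∀ x, g (g x) = x) ∧ (∀ x, g x ≠ x) ∧
      ∀ p q, M.Adj p q ↔ g p = q := by
  rw [mem_perfectMatchings] at hM
  choose g hg hu using hM
  have hgg : ∀ x, g (g x) = x := fun x => (hu (g x) x (hg x).symm).symm
  refine ⟨⟨g, g, hgg, hgg⟩, hgg, fun x h => M.loopless.irrefl x ?_, fun p q => ⟨fun h => (hu p q h).symm, ?_⟩⟩
  · have := hg x
    rwa [show g x = x from h] at this
  · rintro rfl
    exact hg p

/-- The involution that belongs to a perfect matching. -/
noncomputable def partner {k : ℕ} (M : PositionGraph k) (hM : M ∈ perfectMatchings k) :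
    Equiv.Perm (Position k) :=
  (exists_pairing_of_perfectMatching hM).choose

theorem partner_spec {k : ℕ} (M : PositionGraph k) (hM : M ∈ perfectMatchings k) :
    (∀ x, partner M hM (partner M hM x) = x) ∧ (∀ x, partner M hM x ≠ x) ∧
      ∀ p q, M.Adj p q ↔ partner M hM p = q :=
  (exists_pairing_of_perfectMatching hM).choose_spec

open Classical in
-- A perfect matching is the same thing as a fixed-point-free involution sending each position to
-- its partner.
theorem card_pairings_univ {k : ℕ} {κ : Type*} [DecidableEq κ] (f : Position k → κ) :
    (pairings Finset.univ f).card =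
      {M ∈ perfectMatchings k | ∀ p q, M.Adj p q → f p = f q}.card := by
  symm
  refine Finset.card_bij (fun M hM => partner M (Finset.mem_filter.1 hM).1) ?_ ?_ ?_
  · intro M hM
    rw [Finset.mem_filter] at hM
    obtain ⟨h1, h2, h3⟩ := partner_spec M hM.1
    rw [mem_pairings]
    exact ⟨h1, fun x => by simp [h2 x], fun x => (hM.2 _ _ ((h3 x _).2 rfl)).symm⟩
  · intro M hM M' hM' h
    have h3 := (partner_spec M (Finset.mem_filter.1 hM).1).2.2
    have h3' := (partner_spec M' (Finset.mem_filter.1 hM').1).2.2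
    have hv : ∀ {N : PositionGraph k}, N ∈ perfectMatchings k → N.verts = Set.univ := by
      intro N hN
      refine Set.eq_univ_of_forall fun p => ?_
      obtain ⟨q, hq, -⟩ := mem_perfectMatchings.1 hN p
      exact N.edge_vert hq
    refine SimpleGraph.Subgraph.ext ?_ ?_
    · rw [hv (Finset.mem_filter.1 hM).1, hv (Finset.mem_filter.1 hM').1]
    · ext p q
      rw [h3, h3', h]
  · intro g hg
    obtain ⟨h1, h2, h3⟩ := mem_pairings.1 hg
    have h2' : ∀ x, g x ≠ x := fun x => (h2 x).2 (Finset.mem_univ x)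
    have hM : matchingOfPerm g h1 h2' ∈ perfectMatchings k :=
      mem_perfectMatchings.2 fun p => ⟨g p, rfl, fun q hq => (show g p = q from hq).symm⟩
    refine ⟨matchingOfPerm g h1 h2', Finset.mem_filter.2 ⟨hM, ?_⟩, ?_⟩
    · rintro p q rfl
      exact (h3 p).symm
    · ext1 p
      exact ((partner_spec _ hM).2.2 p (g p)).1 rfl

theorem card_perfectMatchings (k : ℕ) : (perfectMatchings k).card = (2 * k - 1)‼ := by
  classical
  -- A constant labelling imposes no condition, so all matchings are counted.
  have h := card_pairings_univ (k := k) fun _ => ()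
  rw [card_pairings_const k _ _ (by simp [mul_comm])] at h
  simpa using h.symm

/-! ### Traces of powers as sums over cyclic index sequences -/

/-- The extra factor `B` makes the induction work: one copy of `A` is absorbed into it, by `A ^ (k +
1) * B = A ^ k * (A * B)`. -/
theorem trace_pow_mul_eq_sum {α R : Type*} [Fintype α] [DecidableEq α] [CommSemiring R]
    (A B : Matrix α α R) (k : ℕ) :
    (A ^ k * B).trace = ∑ i : Fin (k + 1) → α,
      (∏ t : Fin k, A (i t.castSucc) (i t.succ)) * B (i (Fin.last k)) (i 0) := by
  induction k generalizing B with
  | zero =>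
    rw [pow_zero, one_mul, Matrix.trace, ← (Equiv.funUnique (Fin 1) α).symm.sum_comp]
    simp [Matrix.diag]
  | succ k ih =>
    rw [pow_succ, mul_assoc, ih, ← (Fin.snocEquiv fun _ : Fin (k + 2) => α).sum_comp,
      Fintype.sum_prod_type, Finset.sum_comm]
    refine Finset.sum_congr rfl fun i _ => ?_
    rw [Matrix.mul_apply, Finset.mul_sum]
    refine Finset.sum_congr rfl fun c _ => ?_
    have h0 : Fin.snoc (α := fun _ => α) i c 0 = i 0 := by
      rw [← Fin.castSucc_zero, Fin.snoc_castSucc]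
    rw [Fin.prod_univ_castSucc]
    simp only [Fin.snocEquiv_apply, ← Fin.castSucc_succ, Fin.snoc_castSucc, Fin.succ_last, Fin.snoc_last, h0]
    ring

/-- With `B = A` the extra factor closes the cycle, which is the wrap-around of `finRotate`. At `k =
0` it would fail: the trace is the cardinality of `α`, the sum is `1`. -/
theorem trace_pow_eq_sum {α R : Type*} [Fintype α] [DecidableEq α] [CommSemiring R]
    (A : Matrix α α R) {k : ℕ} (hk : 1 ≤ k) :
    (A ^ k).trace = ∑ i : Fin k → α, ∏ t, A (i t) (i (finRotate k t)) := by
  obtain ⟨k, rfl⟩ : ∃ l, k = l + 1 := ⟨k - 1, by omega⟩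
  rw [pow_succ, trace_pow_mul_eq_sum]
  refine Finset.sum_congr rfl fun i _ => ?_
  rw [Fin.prod_univ_castSucc]
  simp

theorem trace_mul_transpose_pow_eq_sum {α β R : Type*} [Fintype α] [DecidableEq α] [Fintype β]
    [CommSemiring R] (A : Matrix α β R) {k : ℕ} (hk : 1 ≤ k) :
    ((A * A.transpose) ^ k).trace = ∑ i : Fin k → α, ∑ j : Fin k → β,
      ∏ p : Position k, A (i (rowLabel p)) (j (colLabel p)) := by
  classical
  rw [trace_pow_eq_sum _ hk]
  refine Finset.sum_congr rfl fun i _ => ?_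
  simp only [Matrix.mul_apply, Finset.prod_univ_sum, Fintype.piFinset_univ]
  refine Finset.sum_congr rfl fun j _ => ?_
  rw [Fintype.prod_prod_type]
  refine Finset.prod_congr rfl fun t _ => ?_
  simp [rowLabel, colLabel, mul_comm]

/-! ### Labellings that are constant on components -/

/-- A function constant along edges is constant along walks, hence factors uniquely through the
connected components. -/
theorem card_forall_adj_eq {V α : Type*} [Finite V] (G : SimpleGraph V) :
    Nat.card {j : V → α // ∀ s t, G.Adj s t → j s = j t} =
      Nat.card α ^ Nat.card G.ConnectedComponent := by
  have hw : ∀ j : V → α, (∀ s t, G.Adj s t → j s = j t) → ∀ s t, G.Walk s t → j s = j t := by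
    intro j hj s t w
    induction w with
    | nil => rfl
    | cons h _ ih => exact (hj _ _ h).trans ih
  let e : {j : V → α // ∀ s t, G.Adj s t → j s = j t} ≃ (G.ConnectedComponent → α) :=
    { toFun := fun j => SimpleGraph.ConnectedComponent.lift j.1 fun s t w _ => hw j.1 j.2 s t w
      invFun := fun c => ⟨fun s => c (G.connectedComponentMk s), fun s t h => by
        simp only [SimpleGraph.ConnectedComponent.connectedComponentMk_eq_of_adj h]⟩
      left_inv := fun j => by ext; rfl
      right_inv := fun c => by
        ext x
        induction x using SimpleGraph.ConnectedComponent.ind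
        rfl }
  rw [Nat.card_congr e, Nat.card_fun]

theorem forall_inducedGraph_adj {k : ℕ} {α : Type*} (label : Position k → Fin k) (M : PositionGraph k)
    (j : Fin k → α) :
    (∀ s t, (inducedGraph label M).Adj s t → j s = j t) ↔
      ∀ p q, M.Adj p q → j (label p) = j (label q) := by
  constructor
  · intro h p q hpq
    by_cases hne : label p = label q
    · rw [hne]
    · exact h _ _ ((SimpleGraph.fromRel_adj _ _ _).2 ⟨hne, Or.inl ⟨p, q, hpq, rfl, rfl⟩⟩)
  · intro h s t hst
    obtain ⟨-, ⟨p, q, hpq, rfl, rfl⟩ | ⟨p, q, hpq, rfl, rfl⟩⟩ := (SimpleGraph.fromRel_adj _ _ _).1 hst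
    · exact h p q hpq
    · exact (h p q hpq).symm

open Classical in
theorem card_labellings {k : ℕ} {α : Type*} [Fintype α] (label : Position k → Fin k)
    (M : PositionGraph k) :
    (Finset.univ.filter fun j : Fin k → α => ∀ p q, M.Adj p q → j (label p) = j (label q)).card =
      Fintype.card α ^ Nat.card (inducedGraph label M).ConnectedComponent := by
  rw [← Nat.card_eq_fintype_card, ← card_forall_adj_eq, ← Fintype.card_subtype,
    ← Nat.card_eq_fintype_card]
  refine Nat.card_congr (Equiv.subtypeEquivRight fun j => ?_)
  exact (forall_inducedGraph_adj label M j).symm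

/-! ### The moments as sums over perfect matchings -/

/-- The matrix `X Xᵀ` for the generic `m × n` matrix `X`. -/
noncomputable def genericWishart (R : Type*) [CommSemiring R] (m n : ℕ) :
    Matrix (Fin m) (Fin m) (MvPolynomial (Fin m × Fin n) R) :=
  Matrix.mvPolynomialX (Fin m) (Fin n) R * (Matrix.mvPolynomialX (Fin m) (Fin n) R).transpose

theorem gaussFunctional_trace_pow {R : Type*} [CommSemiring R] (v : R) (m n : ℕ) {k : ℕ} (hk : 1 ≤ k) :
    gaussFunctional v (genericWishart R m n ^ k).trace =
      v ^ k * ∑ M ∈ perfectMatchings k, (n : R) ^ colComponents M * (m : R) ^ rowComponents M := by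
  classical
  rw [genericWishart, trace_mul_transpose_pow_eq_sum _ hk]
  simp only [Matrix.mvPolynomialX_apply, map_sum]
  have hcard : (Finset.univ : Finset (Position k)).card = 2 * k := by simp [mul_comm]
  have h : ∀ (i : Fin k → Fin m) (j : Fin k → Fin n), gaussFunctional v (∏ p : Position k,
      (MvPolynomial.X (i (rowLabel p), j (colLabel p)) : MvPolynomial (Fin m × Fin n) R)) =
      v ^ k * ((∑ M ∈ perfectMatchings k,
        (if ∀ p q, M.Adj p q → j (colLabel p) = j (colLabel q) then 1 else 0) *
        (if ∀ p q, M.Adj p q → i (rowLabel p) = i (rowLabel q) then 1 else 0) : ℕ) : R) := by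
    intro i j
    rw [gaussFunctional_prod_X v (fun p => (i (rowLabel p), j (colLabel p))) k _ hcard,
      card_pairings_univ, Finset.card_filter]
    congr 2
    refine Finset.sum_congr rfl fun M _ => ?_
    -- Equality of the variables at two positions is equality of both indices, so the indicator
    -- splits into a row and a column factor and the sums over `i` and `j` separate.
    rw [ite_zero_mul_ite_zero, mul_one]
    refine if_congr ?_ rfl rfl
    simp only [Prod.mk.injEq, imp_and, forall_and]
    exact and_comm
  simp only [h, ← Finset.mul_sum, ← Nat.cast_sum]
  congr 1
  have h2 : (∑ i : Fin k → Fin m, ∑ j : Fin k → Fin n, ∑ M ∈ perfectMatchings k,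
        (if ∀ p q, M.Adj p q → j (colLabel p) = j (colLabel q) then 1 else 0) *
        (if ∀ p q, M.Adj p q → i (rowLabel p) = i (rowLabel q) then 1 else 0) : ℕ) =
      ∑ M ∈ perfectMatchings k, n ^ colComponents M * m ^ rowComponents M := by
    simp only [Finset.sum_comm (t := perfectMatchings k)]
    refine Finset.sum_congr rfl fun M _ => ?_
    simp only [← Finset.sum_mul, ← Finset.mul_sum]
    have hc := card_labellings (α := Fin n) colLabel M
    have hr := card_labellings (α := Fin m) rowLabel M
    rw [Finset.card_filter, Fintype.card_fin] at hc hr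
    rw [colComponents, rowComponents]
    convert congrArg₂ (· * ·) hc hr
  rw [h2]
  push_cast
  rfl

theorem sum_perfectMatchings_eq {R : Type*} [CommSemiring R] (x y : R) {k : ℕ}
    (hab : ∀ M : PositionGraph k, colComponents M ≤ k ∧ rowComponents M ≤ k) :
    ∑ M ∈ perfectMatchings k, x ^ colComponents M * y ^ rowComponents M =
      ∑ a ∈ Finset.range (k + 1), ∑ b ∈ Finset.range (k + 1), (coeff k a b : R) * x ^ a * y ^ b := by
  classical
  rw [← Finset.sum_fiberwise_of_maps_to (s := perfectMatchings k) (t := Finset.range (k + 1))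
    (g := colComponents) fun M _ => Finset.mem_range_succ_iff.2 (hab M).1]
  refine Finset.sum_congr rfl fun a _ => ?_
  rw [← Finset.sum_fiberwise_of_maps_to (t := Finset.range (k + 1))
    (g := rowComponents) fun M _ => Finset.mem_range_succ_iff.2 (hab M).2]
  refine Finset.sum_congr rfl fun b _ => ?_
  rw [Finset.filter_filter, coeff, mul_assoc, ← nsmul_eq_mul]
  refine Finset.sum_eq_card_nsmul ?_
  intro M hM
  obtain ⟨-, rfl, rfl⟩ := Finset.mem_filter.1 hM
  rfl

theorem card_connectedComponent_le {k : ℕ} (G : SimpleGraph (Fin k)) :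
    Nat.card G.ConnectedComponent ≤ k := by
  simpa using Nat.card_le_card_of_surjective G.connectedComponentMk
    fun c => c.exists_rep

theorem card_connectedComponent_pos {k : ℕ} (hk : 1 ≤ k) (G : SimpleGraph (Fin k)) :
    1 ≤ Nat.card G.ConnectedComponent :=
  have : Nonempty G.ConnectedComponent := ⟨G.connectedComponentMk ⟨0, hk⟩⟩
  Nat.card_pos

theorem components_le {k : ℕ} (M : PositionGraph k) : colComponents M ≤ k ∧ rowComponents M ≤ k :=
  ⟨card_connectedComponent_le _, card_connectedComponent_le _⟩

theorem components_pos {k : ℕ} (hk : 1 ≤ k) (M : PositionGraph k) :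
    1 ≤ colComponents M ∧ 1 ≤ rowComponents M :=
  ⟨card_connectedComponent_pos hk _, card_connectedComponent_pos hk _⟩

theorem bounds_of_coeff_ne_zero {k a b : ℕ} (hk : 1 ≤ k) (h : coeff k a b ≠ 0) :
    (1 ≤ a ∧ a ≤ k) ∧ 1 ≤ b ∧ b ≤ k := by
  obtain ⟨M, hM⟩ := Finset.card_ne_zero.1 h
  obtain ⟨-, rfl, rfl⟩ := Finset.mem_filter.1 hM
  exact ⟨⟨(components_pos hk M).1, (components_le M).1⟩, (components_pos hk M).2, (components_le M).2⟩

/-! ### The loop equation for mixed moments of traces -/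

section LoopEquation

variable {R : Type*} [CommSemiring R] {m n : ℕ}

local notation "𝐗" => Matrix.mvPolynomialX (Fin m) (Fin n) R
local notation "𝐒" => genericWishart R m n

theorem genericWishart_pow_transpose (k : ℕ) : (𝐒 ^ k).transpose = 𝐒 ^ k := by
  rw [Matrix.transpose_pow, genericWishart, Matrix.transpose_mul, Matrix.transpose_transpose]

theorem transpose_mul_genericWishart_pow_apply (k : ℕ) (i : Fin m) (j : Fin n) :
    (𝐗.transpose * 𝐒 ^ k) j i = (𝐒 ^ k * 𝐗) i j := by
  rw [← Matrix.transpose_apply (𝐗.transpose * 𝐒 ^ k), Matrix.transpose_mul,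
    genericWishart_pow_transpose, Matrix.transpose_transpose]

theorem pderiv_mvPolynomialX (i a : Fin m) (j b : Fin n) :
    MvPolynomial.pderiv (i, j) (𝐗 a b) = if a = i ∧ b = j then 1 else 0 := by
  rw [Matrix.mvPolynomialX_apply, MvPolynomial.pderiv_X, Pi.single_apply]
  simp only [Prod.mk.injEq]

theorem pderiv_genericWishart (i a c : Fin m) (j : Fin n) :
    MvPolynomial.pderiv (i, j) (𝐒 a c) =
      (if a = i then 𝐗 c j else 0) + (if c = i then 𝐗 a j else 0) := by
  rw [genericWishart, Matrix.mul_apply, map_sum]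
  simp only [Matrix.transpose_apply, MvPolynomial.pderiv_mul, pderiv_mvPolynomialX,
    Finset.sum_add_distrib, ite_and]
  congr 1
  · split_ifs <;> simp
  · split_ifs <;> simp

/-- Leibniz rule: `l` is the place of the differentiated factor `S = X Xᵀ`, and the two summands
come from hitting its `X` or its `Xᵀ`. -/
theorem pderiv_genericWishart_pow (k : ℕ) (i a b : Fin m) (j : Fin n) :
    MvPolynomial.pderiv (i, j) ((𝐒 ^ k) a b) = ∑ l ∈ Finset.range k,
      ((𝐒 ^ l) a i * (𝐗.transpose * 𝐒 ^ (k - 1 - l)) j b +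
        (𝐒 ^ l * 𝐗) a j * (𝐒 ^ (k - 1 - l)) i b) := by
  induction k generalizing a with
  | zero =>
    rw [pow_zero, Matrix.one_apply]
    split_ifs <;> simp
  | succ k ih =>
    have h1 : ∑ c, 𝐒 a c * MvPolynomial.pderiv (i, j) ((𝐒 ^ k) c b) = ∑ l ∈ Finset.range k,
        ((𝐒 ^ (l + 1)) a i * (𝐗.transpose * 𝐒 ^ (k - 1 - l)) j b +
          (𝐒 ^ (l + 1) * 𝐗) a j * (𝐒 ^ (k - 1 - l)) i b) := by
      simp only [ih, Finset.mul_sum]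
      rw [Finset.sum_comm]
      refine Finset.sum_congr rfl fun l _ => ?_
      rw [pow_succ', Matrix.mul_assoc, Matrix.mul_apply (M := 𝐒) (N := 𝐒 ^ l),
        Matrix.mul_apply (M := 𝐒) (N := 𝐒 ^ l * 𝐗), Finset.sum_mul, Finset.sum_mul,
        ← Finset.sum_add_distrib]
      exact Finset.sum_congr rfl fun c _ => by ring
    have h2 : ∑ c, MvPolynomial.pderiv (i, j) (𝐒 a c) * (𝐒 ^ k) c b =
        (1 : Matrix (Fin m) (Fin m) _) a i * (𝐗.transpose * 𝐒 ^ k) j b + 𝐗 a j * (𝐒 ^ k) i b := by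
      simp only [pderiv_genericWishart, add_mul]
      rw [Finset.sum_add_distrib, Matrix.one_apply, Matrix.mul_apply]
      refine congrArg₂ (· + ·) ?_ ?_
      · split_ifs <;> simp
      · simp
    rw [pow_succ', Matrix.mul_apply, map_sum, Finset.sum_range_succ']
    simp only [MvPolynomial.pderiv_mul]
    rw [Finset.sum_add_distrib, h1, h2, add_comm]
    simp only [pow_zero, Matrix.one_mul, Nat.add_sub_cancel, Nat.sub_zero]
    refine congrArg (· + _) (Finset.sum_congr rfl fun l _ => ?_)
    rw [show k - (l + 1) = k - 1 - l by omega]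

/-- By symmetry of `S`, the `2 * q` occurrences of `X` and `Xᵀ` under the trace contribute equally.
-/
theorem pderiv_trace_genericWishart_pow (q : ℕ) (i : Fin m) (j : Fin n) :
    MvPolynomial.pderiv (i, j) (𝐒 ^ q).trace = (2 * q : ℕ) * (𝐒 ^ (q - 1) * 𝐗) i j := by
  have h : ∀ l r, ∑ a, ((𝐒 ^ l) a i * (𝐗.transpose * 𝐒 ^ r) j a +
      (𝐒 ^ l * 𝐗) a j * (𝐒 ^ r) i a) = 2 * (𝐒 ^ (r + l) * 𝐗) i j := by
    intro l r
    have h1 : ∑ a, (𝐒 ^ l) a i * (𝐗.transpose * 𝐒 ^ r) j a = (𝐒 ^ (r + l) * 𝐗) i j := by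
      rw [← transpose_mul_genericWishart_pow_apply, pow_add, ← Matrix.mul_assoc, Matrix.mul_apply]
      exact Finset.sum_congr rfl fun a _ => mul_comm _ _
    have h2 : ∑ a, (𝐒 ^ l * 𝐗) a j * (𝐒 ^ r) i a = (𝐒 ^ (r + l) * 𝐗) i j := by
      rw [pow_add, Matrix.mul_assoc, Matrix.mul_apply]
      exact Finset.sum_congr rfl fun a _ => mul_comm _ _
    rw [Finset.sum_add_distrib, h1, h2, two_mul]
  have h' : ∀ l ∈ Finset.range q, ∑ a, ((𝐒 ^ l) a i * (𝐗.transpose * 𝐒 ^ (q - 1 - l)) j a +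
      (𝐒 ^ l * 𝐗) a j * (𝐒 ^ (q - 1 - l)) i a) = 2 * (𝐒 ^ (q - 1) * 𝐗) i j := by
    intro l hl
    rw [h, Nat.sub_add_cancel (by have := Finset.mem_range.1 hl; omega)]
  simp only [Matrix.trace, Matrix.diag, map_sum, pderiv_genericWishart_pow]
  rw [Finset.sum_comm, Finset.sum_congr rfl h', Finset.sum_const, Finset.card_range, nsmul_eq_mul]
  push_cast
  ring

/-- The leading `Xᵀ` gives `n` copies of the trace. Hitting an `X` inside `S ^ k` reconnects to a
single trace, `k` times in all; hitting an `Xᵀ` splits the trace in two. -/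
theorem sum_pderiv_transpose_mul_genericWishart_pow (k : ℕ) :
    ∑ i, ∑ j, MvPolynomial.pderiv (i, j) ((𝐗.transpose * 𝐒 ^ k) j i) =
      (n + k : ℕ) * (𝐒 ^ k).trace +
        ∑ l ∈ Finset.range k, (𝐒 ^ (l + 1)).trace * (𝐒 ^ (k - 1 - l)).trace := by
  have h : ∀ i j, MvPolynomial.pderiv (i, j) ((𝐗.transpose * 𝐒 ^ k) j i) = (𝐒 ^ k) i i +
      ∑ l ∈ Finset.range k, ((𝐒 ^ l * 𝐗) i j * (𝐗.transpose * 𝐒 ^ (k - 1 - l)) j i +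
        (𝐗.transpose * (𝐒 ^ l * 𝐗)) j j * (𝐒 ^ (k - 1 - l)) i i) := by
    intro i j
    have h1 : ∑ c, 𝐗 c j * MvPolynomial.pderiv (i, j) ((𝐒 ^ k) c i) = ∑ l ∈ Finset.range k,
        ((𝐒 ^ l * 𝐗) i j * (𝐗.transpose * 𝐒 ^ (k - 1 - l)) j i +
          (𝐗.transpose * (𝐒 ^ l * 𝐗)) j j * (𝐒 ^ (k - 1 - l)) i i) := by
      simp only [pderiv_genericWishart_pow, Finset.mul_sum]
      rw [Finset.sum_comm]
      refine Finset.sum_congr rfl fun l _ => ?_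
      rw [← transpose_mul_genericWishart_pow_apply,
        Matrix.mul_apply (M := 𝐗.transpose) (N := 𝐒 ^ l),
        Matrix.mul_apply (M := 𝐗.transpose) (N := 𝐒 ^ l * 𝐗), Finset.sum_mul, Finset.sum_mul,
        ← Finset.sum_add_distrib]
      refine Finset.sum_congr rfl fun c _ => ?_
      rw [Matrix.transpose_apply]
      ring
    rw [Matrix.mul_apply, map_sum]
    simp only [MvPolynomial.pderiv_mul, Matrix.transpose_apply]
    rw [Finset.sum_add_distrib, h1]
    refine congrArg (· + _) ?_
    simp only [pderiv_mvPolynomialX]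
    simp
  have h1 : ∀ l ∈ Finset.range k, ∑ i, ∑ j, (𝐒 ^ l * 𝐗) i j * (𝐗.transpose * 𝐒 ^ (k - 1 - l)) j i =
      (𝐒 ^ k).trace := by
    intro l hl
    have hl : k = l + (1 + (k - 1 - l)) := by have := Finset.mem_range.1 hl; omega
    conv_rhs => rw [hl, pow_add, pow_add, pow_one, genericWishart, Matrix.mul_assoc,
      ← genericWishart, ← Matrix.mul_assoc]
    rfl
  have h2 : ∀ l, ∑ j, (𝐗.transpose * (𝐒 ^ l * 𝐗)) j j = (𝐒 ^ (l + 1)).trace := by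
    intro l
    rw [pow_succ]
    conv_rhs => rw [genericWishart, ← Matrix.mul_assoc, ← genericWishart, Matrix.trace_mul_comm]
    rfl
  simp only [h, Finset.sum_add_distrib]
  have h3 : ∑ i : Fin m, ∑ _j : Fin n, (𝐒 ^ k) i i = n * (𝐒 ^ k).trace := by
    simp [Matrix.trace, Finset.mul_sum]
  have h4 : ∑ i, ∑ j, ∑ l ∈ Finset.range k, (𝐒 ^ l * 𝐗) i j * (𝐗.transpose * 𝐒 ^ (k - 1 - l)) j i =
      k * (𝐒 ^ k).trace := by
    simp only [Finset.sum_comm (t := Finset.range k)]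
    rw [Finset.sum_congr rfl h1]
    simp
  have h5 : ∑ i, ∑ j, ∑ l ∈ Finset.range k,
      (𝐗.transpose * (𝐒 ^ l * 𝐗)) j j * (𝐒 ^ (k - 1 - l)) i i =
      ∑ l ∈ Finset.range k, (𝐒 ^ (l + 1)).trace * (𝐒 ^ (k - 1 - l)).trace := by
    simp only [Finset.sum_comm (t := Finset.range k)]
    refine Finset.sum_congr rfl fun l _ => ?_
    simp only [← Finset.sum_mul, ← Finset.mul_sum, h2]
    rfl
  rw [h3, h4, h5]
  push_cast
  ring

/-- Differentiating another trace merges it with the open word `Xᵀ S ^ k` into one trace. -/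
theorem sum_transpose_mul_pderiv_trace (k q : ℕ) :
    ∑ i, ∑ j, (𝐗.transpose * 𝐒 ^ k) j i * MvPolynomial.pderiv (i, j) (𝐒 ^ q).trace =
      (2 * q : ℕ) * (𝐒 ^ (k + q)).trace := by
  rcases q with _ | q
  · simp
  have h : 𝐒 ^ (k + (q + 1)) = 𝐒 ^ k * 𝐗 * (𝐗.transpose * 𝐒 ^ q) := by
    rw [pow_add, pow_succ', ← Matrix.mul_assoc]
    conv_lhs => enter [1, 2]; rw [genericWishart]
    simp only [Matrix.mul_assoc]
  rw [h]
  simp only [pderiv_trace_genericWishart_pow, Nat.add_sub_cancel]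
  rw [Matrix.trace, Finset.mul_sum]
  refine Finset.sum_congr rfl fun i _ => ?_
  rw [Matrix.diag, Matrix.mul_apply, Finset.mul_sum]
  refine Finset.sum_congr rfl fun j _ => ?_
  rw [transpose_mul_genericWishart_pow_apply, transpose_mul_genericWishart_pow_apply]
  ring

variable (R m n) in
/-- The product of the power sums `tr (S ^ q)` over the exponents `q` in a list. -/
noncomputable def powerSumProd (l : List ℕ) : MvPolynomial (Fin m × Fin n) R :=
  (l.map fun q => (𝐒 ^ q).trace).prod

theorem powerSumProd_cons (q : ℕ) (l : List ℕ) :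
    powerSumProd R m n (q :: l) = (𝐒 ^ q).trace * powerSumProd R m n l := by
  simp [powerSumProd]

/-- An entry `(c, l)` stands for `c` times the product of the power sums with exponents in `l`. -/
abbrev MomentTerm : Type := ℕ × List ℕ

variable (R m n) in
/-- The polynomial that a list of terms stands for. -/
noncomputable def termsPoly (L : List MomentTerm) : MvPolynomial (Fin m × Fin n) R :=
  (L.map fun t => (t.1 : MvPolynomial (Fin m × Fin n) R) * powerSumProd R m n t.2).sum

theorem termsPoly_nil : termsPoly R m n [] = 0 := rfl

theorem termsPoly_cons (t : MomentTerm) (L : List MomentTerm) :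
    termsPoly R m n (t :: L) = t.1 * powerSumProd R m n t.2 + termsPoly R m n L := by
  simp [termsPoly]

theorem termsPoly_append (L L' : List MomentTerm) :
    termsPoly R m n (L ++ L') = termsPoly R m n L + termsPoly R m n L' := by
  simp [termsPoly]

/-- The terms that arise from the derivatives of the power sums with exponents in a list, when `S ^ k`
is inserted. -/
def mergeTerms (k : ℕ) : List ℕ → List MomentTerm
  | [] => []
  | q :: l => (2 * q, (k + q) :: l) :: (mergeTerms k l).map fun t => (t.1, q :: t.2)

theorem termsPoly_mergeTerms (k : ℕ) (l : List ℕ) :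
    termsPoly R m n (mergeTerms k l) = ∑ i, ∑ j, (𝐗.transpose * 𝐒 ^ k) j i *
      MvPolynomial.pderiv (i, j) (powerSumProd R m n l) := by
  induction l with
  | nil => simp [mergeTerms, termsPoly, powerSumProd]
  | cons q l ih =>
    have h : termsPoly R m n ((mergeTerms k l).map fun t => (t.1, q :: t.2)) =
        (𝐒 ^ q).trace * termsPoly R m n (mergeTerms k l) := by
      rw [termsPoly, termsPoly, List.map_map, ← List.sum_map_mul_left]
      refine congrArg List.sum (List.map_congr_left fun t _ => ?_)
      simp only [Function.comp_apply, powerSumProd_cons]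
      ring
    rw [mergeTerms, termsPoly_cons, h, ih, powerSumProd_cons, ← mul_assoc,
      ← sum_transpose_mul_pderiv_trace, Finset.sum_mul, Finset.mul_sum, ← Finset.sum_add_distrib]
    refine Finset.sum_congr rfl fun i _ => ?_
    rw [Finset.sum_mul, Finset.mul_sum, ← Finset.sum_add_distrib]
    refine Finset.sum_congr rfl fun j _ => ?_
    rw [powerSumProd_cons, MvPolynomial.pderiv_mul]
    ring

/-- The terms of the loop equation for the power sums with exponents in a list. -/
def expand (m n : ℕ) : List ℕ → List MomentTerm
  | [] => [(1, [])]
  | 0 :: l => [(m, l)]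
  | (k + 1) :: l => (n + k, k :: l) ::
      (((List.range k).map fun a => (1, (a + 1) :: (k - 1 - a) :: l)) ++ mergeTerms k l)

/-- Write the leading trace as a sum of `X (i, j)` times an entry of `Xᵀ S ^ k` and integrate by
parts: the derivative either stays in that trace or merges it with another one. -/
theorem gaussFunctional_expand (l : List ℕ) :
    gaussFunctional (1 : R) (termsPoly R m n (expand m n l)) =
      gaussFunctional 1 (powerSumProd R m n l) := by
  rcases l with _ | ⟨_ | k, l⟩
  · simp [expand, termsPoly]
  · simp [expand, termsPoly, powerSumProd_cons]
  · have h1 : powerSumProd R m n ((k + 1) :: l) =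
        ∑ i, ∑ j, MvPolynomial.X (i, j) * ((𝐗.transpose * 𝐒 ^ k) j i * powerSumProd R m n l) := by
      have h : 𝐒 ^ (k + 1) = 𝐗 * (𝐗.transpose * 𝐒 ^ k) := by
        rw [pow_succ', ← Matrix.mul_assoc]
        rfl
      rw [powerSumProd_cons, h, Matrix.trace, Finset.sum_mul]
      refine Finset.sum_congr rfl fun i _ => ?_
      rw [Matrix.diag, Matrix.mul_apply, Finset.sum_mul]
      exact Finset.sum_congr rfl fun j _ => by rw [Matrix.mvPolynomialX_apply, mul_assoc]
    have h2 : termsPoly R m n ((List.range k).map fun a => (1, (a + 1) :: (k - 1 - a) :: l)) =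
        (∑ a ∈ Finset.range k, (𝐒 ^ (a + 1)).trace * (𝐒 ^ (k - 1 - a)).trace) *
          powerSumProd R m n l := by
      rw [termsPoly, List.map_map, Finset.sum_mul]
      simp [Finset.sum, powerSumProd_cons, Function.comp_def, mul_assoc, Multiset.range]
    rw [h1, expand, termsPoly_cons, termsPoly_append, h2, termsPoly_mergeTerms]
    simp only [map_sum, gaussFunctional_X_mul, one_mul, MvPolynomial.pderiv_mul]
    simp only [← map_sum]
    refine congrArg _ ?_
    simp only [Finset.sum_add_distrib, ← Finset.sum_mul,
      sum_pderiv_transpose_mul_genericWishart_pow, powerSumProd_cons]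
    ring

/-! ### Evaluation of the loop equation -/

/-- Insert an exponent into a sorted list of exponents; the exponent `0` becomes a factor `m`. -/
def insertExponent (m q : ℕ) (t : MomentTerm) : MomentTerm :=
  if q = 0 then (m * t.1, t.2) else (t.1, t.2.orderedInsert (· ≤ ·) q)

theorem powerSumProd_perm {l l' : List ℕ} (h : l.Perm l') :
    powerSumProd R m n l = powerSumProd R m n l' :=
  (h.map _).prod_eq

theorem termsPoly_insertExponent (q : ℕ) (t : MomentTerm) :
    termsPoly R m n [insertExponent m q t] = termsPoly R m n [(t.1, q :: t.2)] := by
  simp only [termsPoly_cons, insertExponent, powerSumProd_cons]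
  split_ifs with h
  · subst h
    simp
    ring
  · rw [powerSumProd_perm (List.perm_orderedInsert _ q t.2), powerSumProd_cons]

/-- Sort the exponents of a term. -/
def sortTerm (m : ℕ) (t : MomentTerm) : MomentTerm :=
  t.2.foldr (insertExponent m) (t.1, [])

theorem termsPoly_sortTerm (t : MomentTerm) :
    termsPoly R m n [sortTerm m t] = termsPoly R m n [t] := by
  obtain ⟨c, l⟩ := t
  induction l with
  | nil => rfl
  | cons q l ih =>
    change termsPoly R m n [insertExponent m q (sortTerm m (c, l))] = _
    rw [termsPoly_insertExponent]
    simp only [termsPoly_cons, termsPoly_nil, add_zero, powerSumProd_cons] at ih ⊢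
    rw [mul_left_comm, ih]
    ring

/-- Add a term to a list of terms, combining it with a term that has the same exponents. -/
def addTerm (t : MomentTerm) : List MomentTerm → List MomentTerm
  | [] => [t]
  | u :: L => if t.2 = u.2 then (t.1 + u.1, u.2) :: L else u :: addTerm t L

theorem termsPoly_addTerm (t : MomentTerm) (L : List MomentTerm) :
    termsPoly R m n (addTerm t L) = termsPoly R m n (t :: L) := by
  induction L with
  | nil => rfl
  | cons u L ih =>
    rw [addTerm]
    split_ifs with h
    · simp only [termsPoly_cons, h]
      push_cast
      ring
    · rw [termsPoly_cons, ih]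
      simp only [termsPoly_cons]
      ring

theorem termsPoly_foldr_addTerm (L : List MomentTerm) :
    termsPoly R m n (L.foldr addTerm []) = termsPoly R m n L := by
  induction L with
  | nil => rfl
  | cons t L ih => rw [List.foldr_cons, termsPoly_addTerm, termsPoly_cons, ih, termsPoly_cons]

/-- The sorted terms of the loop equation for a multiple of a product of power sums. -/
def expandTerm (m n : ℕ) (t : MomentTerm) : List MomentTerm :=
  (expand m n t.2).map fun u => sortTerm m (t.1 * u.1, u.2)

theorem gaussFunctional_expandTerm (t : MomentTerm) :
    gaussFunctional (1 : R) (termsPoly R m n (expandTerm m n t)) =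
      gaussFunctional 1 (termsPoly R m n [t]) := by
  have h : ∀ L : List MomentTerm, termsPoly R m n (L.map fun u => sortTerm m (t.1 * u.1, u.2)) =
      t.1 * termsPoly R m n L := by
    intro L
    induction L with
    | nil => simp [termsPoly]
    | cons u L ih =>
      have := termsPoly_sortTerm (R := R) (m := m) (n := n) (t.1 * u.1, u.2)
      simp only [termsPoly_cons, termsPoly_nil, add_zero, Nat.cast_mul] at this
      rw [List.map_cons, termsPoly_cons, termsPoly_cons, ih, this]
      ring
  rw [expandTerm, h, gaussFunctional_natCast_mul, gaussFunctional_expand, termsPoly_cons,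
    termsPoly_nil, add_zero, gaussFunctional_natCast_mul]

/-- Apply the loop equation to all terms of a list. -/
def expandTerms (m n : ℕ) (L : List MomentTerm) : List MomentTerm :=
  (L.flatMap (expandTerm m n)).foldr addTerm []

theorem gaussFunctional_expandTerms (L : List MomentTerm) :
    gaussFunctional (1 : R) (termsPoly R m n (expandTerms m n L)) =
      gaussFunctional 1 (termsPoly R m n L) := by
  rw [expandTerms, termsPoly_foldr_addTerm]
  induction L with
  | nil => rfl
  | cons t L ih =>
    rw [List.flatMap_cons, termsPoly_append, map_add, ih, gaussFunctional_expandTerm, ← map_add,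
      ← termsPoly_append, List.singleton_append]

/-- Apply the loop equation repeatedly. -/
def iterateExpand (m n : ℕ) : ℕ → List MomentTerm → List MomentTerm
  | 0, L => L
  | k + 1, L => iterateExpand m n k (expandTerms m n L)

theorem gaussFunctional_iterateExpand (k : ℕ) (L : List MomentTerm) :
    gaussFunctional (1 : R) (termsPoly R m n (iterateExpand m n k L)) =
      gaussFunctional 1 (termsPoly R m n L) := by
  induction k generalizing L with
  | zero => rfl
  | succ k ih => rw [iterateExpand, ih, gaussFunctional_expandTerms]

end LoopEquation

/-- Each round lowers the total exponent by one, and zero exponents are absorbed as factors `m`, so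
`k` rounds leave one constant. Working over `ℕ` with variance `1` makes the hypothesis a
computation. -/
theorem sum_perfectMatchings_of_iterateExpand {m n k N : ℕ} (hk : 1 ≤ k)
    (h : iterateExpand m n k [(1, [k])] = [(N, [])]) :
    ∑ M ∈ perfectMatchings k, n ^ colComponents M * m ^ rowComponents M = N := by
  have h1 := gaussFunctional_trace_pow (1 : ℕ) m n hk
  have h2 := gaussFunctional_iterateExpand (R := ℕ) (m := m) (n := n) k [(1, [k])]
  have h3 : gaussFunctional 1 (termsPoly ℕ m n [(N, [])]) = N := by
    rw [termsPoly_cons, termsPoly_nil, add_zero, gaussFunctional_natCast_mul, powerSumProd,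
      List.map_nil, List.prod_nil, gaussFunctional_one, mul_one, Nat.cast_id]
  have h4 : termsPoly ℕ m n [(1, [k])] = (genericWishart ℕ m n ^ k).trace := by
    simp [termsPoly, powerSumProd]
  rw [h, h3, h4, h1, one_pow, one_mul] at h2
  simpa using h2.symm

/-! ### The tables -/

/-- The base in which the moment has the coefficients as its digits. -/
def digitBase : ℕ := 2 ^ 32

theorem coeff_lt_digitBase {k : ℕ} (hk : k ≤ 10) (a b : ℕ) : coeff k a b < digitBase := by
  refine (Finset.card_le_card (Finset.filter_subset _ _)).trans_lt ?_
  rw [card_perfectMatchings]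
  -- The largest bound, `19‼ = 654729075`, is below `2 ^ 32`.
  interval_cases k <;> decide

theorem eq_of_sum_digits_eq {N B : ℕ} {f g : Fin N → ℕ} (hf : ∀ i, f i < B) (hg : ∀ i, g i < B)
    (h : ∑ i, f i * B ^ (i : ℕ) = ∑ i, g i * B ^ (i : ℕ)) : f = g := by
  have h1 : (fun i => (⟨f i, hf i⟩ : Fin B)) = fun i => ⟨g i, hg i⟩ := by
    apply finFunctionFinEquiv.injective
    apply Fin.ext
    simpa only [finFunctionFinEquiv_apply] using h
  funext i
  exact congrArg Fin.val (congrFun h1 i)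

theorem sum_digits_lt {N B : ℕ} {f : Fin N → ℕ} (hf : ∀ i, f i < B) :
    ∑ i, f i * B ^ (i : ℕ) < B ^ N := by
  have := (finFunctionFinEquiv fun i => (⟨f i, hf i⟩ : Fin B)).isLt
  rwa [finFunctionFinEquiv_apply] at this

/-- The number that has the entries of a matrix as its digits, where the row `r` and the column `c`
belong to the powers `x ^ (k - r)` and `y ^ (c + 1)`. -/
def evalTable {k : ℕ} (T : Matrix (Fin k) (Fin k) ℕ) (x y : ℕ) : ℕ :=
  ∑ r : Fin k, ∑ c : Fin k, T r c * x ^ (k - r : ℕ) * y ^ (c + 1 : ℕ)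

theorem evalTable_coeffMatrix {k : ℕ} (hk : 1 ≤ k) (x y : ℕ) :
    evalTable (coeffMatrix k) x y =
      ∑ M ∈ perfectMatchings k, x ^ colComponents M * y ^ rowComponents M := by
  have h0 : ∀ b, coeff k 0 b = 0 := fun b => by
    by_contra h
    have := (bounds_of_coeff_ne_zero hk h).1.1
    omega
  have h0' : ∀ a, coeff k a 0 = 0 := fun a => by
    by_contra h
    have := (bounds_of_coeff_ne_zero hk h).2.1
    omega
  rw [sum_perfectMatchings_eq x y components_le, Finset.sum_range_succ', evalTable,
    ← Equiv.sum_comp Fin.revPerm]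
  simp only [h0, Finset.sum_range_succ' _ k, h0', Nat.cast_zero, zero_mul, Finset.sum_const_zero,
    add_zero]
  rw [Finset.sum_range]
  refine Finset.sum_congr rfl fun r _ => ?_
  rw [Finset.sum_range]
  refine Finset.sum_congr rfl fun c _ => ?_
  have hr : k - (Fin.rev r : Fin k).val = r + 1 := by rw [Fin.val_rev]; omega
  rw [coeffMatrix, Matrix.of_apply, Fin.revPerm_apply, hr, Nat.cast_id]

/-- Uniqueness of digits twice: columns are digits in base `B ^ N`, and within each column the
entries are digits in base `B`; `k ≤ N` prevents overflow into the next column. -/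
theorem eq_of_evalTable_eq {k B : ℕ} {T T' : Matrix (Fin k) (Fin k) ℕ} (hT : ∀ r c, T r c < B)
    (hT' : ∀ r c, T' r c < B) {N : ℕ} (hN : k ≤ N)
    (h : evalTable T B (B ^ N) = evalTable T' B (B ^ N)) : T = T' := by
  rcases Nat.eq_zero_or_pos k with rfl | hk
  · exact Subsingleton.elim _ _
  have hB : 0 < B := (Nat.zero_le _).trans_lt (hT ⟨0, hk⟩ ⟨0, hk⟩)
  -- Exponents start at `1`, hence the common factor `B * B ^ N`; row `r` carries the power `k - r`,
  -- hence the reversal.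
  have h1 : ∀ T : Matrix (Fin k) (Fin k) ℕ, evalTable T B (B ^ N) =
      B * B ^ N * ∑ c : Fin k, (∑ r : Fin k, T (Fin.rev r) c * B ^ (r : ℕ)) * (B ^ N) ^ (c : ℕ) := by
    intro T
    rw [evalTable, Finset.sum_comm, Finset.mul_sum]
    refine Finset.sum_congr rfl fun c _ => ?_
    rw [← Equiv.sum_comp Fin.revPerm, Finset.sum_mul, Finset.mul_sum]
    refine Finset.sum_congr rfl fun r _ => ?_
    have hr : k - (Fin.rev r : Fin k).val = r + 1 := by rw [Fin.val_rev]; omega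
    rw [Fin.revPerm_apply, hr]
    ring
  have h2 : ∀ {T : Matrix (Fin k) (Fin k) ℕ}, (∀ r c, T r c < B) → ∀ c,
      ∑ r : Fin k, T (Fin.rev r) c * B ^ (r : ℕ) < B ^ N := fun hT c =>
    (sum_digits_lt fun r => hT (Fin.rev r) c).trans_le (Nat.pow_le_pow_right hB hN)
  rw [h1, h1] at h
  have h3 := eq_of_sum_digits_eq (h2 hT) (h2 hT') (Nat.eq_of_mul_eq_mul_left (by positivity) h)
  ext r c
  have h4 := eq_of_sum_digits_eq (fun r => hT (Fin.rev r) c) (fun r => hT' (Fin.rev r) c)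
    (congrFun h3 c)
  simpa using congrFun h4 (Fin.rev r)

theorem coeffMatrix_eq_of_iterateExpand {k : ℕ} (hk : 1 ≤ k) (hk' : k ≤ 10)
    (T : Matrix (Fin k) (Fin k) ℕ) (hT : ∀ r c, Matrix.of.symm T r c < digitBase)
    (h : iterateExpand (digitBase ^ 10) digitBase k [(1, [k])] =
      [(evalTable T digitBase (digitBase ^ 10), [])]) :
    coeffMatrix k = T := by
  refine eq_of_evalTable_eq (fun r c => coeff_lt_digitBase hk' _ _) hT hk' ?_
  rw [evalTable_coeffMatrix hk, sum_perfectMatchings_of_iterateExpand hk h]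

theorem coeffMatrix_one : coeffMatrix 1 = table1 :=
  coeffMatrix_eq_of_iterateExpand (by decide) (by decide) _ (by decide +kernel) (by decide +kernel)

theorem coeffMatrix_two : coeffMatrix 2 = table2 :=
  coeffMatrix_eq_of_iterateExpand (by decide) (by decide) _ (by decide +kernel) (by decide +kernel)

theorem coeffMatrix_three : coeffMatrix 3 = table3 :=
  coeffMatrix_eq_of_iterateExpand (by decide) (by decide) _ (by decide +kernel) (by decide +kernel)

theorem coeffMatrix_four : coeffMatrix 4 = table4 :=
  coeffMatrix_eq_of_iterateExpand (by decide) (by decide) _ (by decide +kernel) (by decide +kernel)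

theorem coeffMatrix_five : coeffMatrix 5 = table5 :=
  coeffMatrix_eq_of_iterateExpand (by decide) (by decide) _ (by decide +kernel) (by decide +kernel)

theorem coeffMatrix_six : coeffMatrix 6 = table6 :=
  coeffMatrix_eq_of_iterateExpand (by decide) (by decide) _ (by decide +kernel) (by decide +kernel)

theorem coeffMatrix_seven : coeffMatrix 7 = table7 :=
  coeffMatrix_eq_of_iterateExpand (by decide) (by decide) _ (by decide +kernel) (by decide +kernel)

theorem coeffMatrix_eight : coeffMatrix 8 = table8 :=
  coeffMatrix_eq_of_iterateExpand (by decide) (by decide) _ (by decide +kernel) (by decide +kernel)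

theorem coeffMatrix_nine : coeffMatrix 9 = table9 :=
  coeffMatrix_eq_of_iterateExpand (by decide) (by decide) _ (by decide +kernel) (by decide +kernel)

theorem coeffMatrix_ten : coeffMatrix 10 = table10 :=
  coeffMatrix_eq_of_iterateExpand (by decide) (by decide) _ (by decide +kernel) (by decide +kernel)

/-! ### The moments of the Wishart matrix -/

theorem trace_wishart_pow_eq_eval {Ω : Type*} {m n : ℕ} (W : Fin m → Fin n → Ω → ℝ) (ω : Ω) (k : ℕ) :
    (wishart W ω ^ k).trace =
      MvPolynomial.eval (fun p : Fin m × Fin n => W p.1 p.2 ω) (genericWishart ℝ m n ^ k).trace := by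
  have h : wishart W ω =
      (MvPolynomial.eval fun p : Fin m × Fin n => W p.1 p.2 ω).mapMatrix (genericWishart ℝ m n) := by
    rw [genericWishart, RingHom.mapMatrix_apply, Matrix.map_mul, wishart]
    congr 1 <;> ext i j <;> simp
  rw [h, ← map_pow]
  simp [Matrix.trace]

theorem integral_trace_wishart_pow {Ω : Type*} [MeasurableSpace Ω] (μ : Measure Ω)
    [IsProbabilityMeasure μ] (m n : ℕ) (σ : ℝ) (W : Fin m → Fin n → Ω → ℝ)
    (hind : iIndepFun (fun p : Fin m × Fin n => W p.1 p.2) μ)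
    (hlaw : ∀ i j, HasLaw (W i j) (gaussianReal 0 (Real.toNNReal (σ ^ 2))) μ) {k : ℕ} (hk : 1 ≤ k) :
    Integrable (fun ω => (wishart W ω ^ k).trace) μ ∧
    ∫ ω, (wishart W ω ^ k).trace ∂μ = σ ^ (2 * k) * ∑ M ∈ perfectMatchings k,
      (n : ℝ) ^ colComponents M * (m : ℝ) ^ rowComponents M := by
  obtain ⟨h1, h2⟩ := integral_eval_of_hasLaw hind (fun p => hlaw p.1 p.2)
    (genericWishart ℝ m n ^ k).trace
  simp only [trace_wishart_pow_eq_eval]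
  refine ⟨h1, ?_⟩
  rw [h2, gaussFunctional_trace_pow _ _ _ hk, Real.coe_toNNReal _ (sq_nonneg σ), ← pow_mul]

end WishartMoments

theorem mainTheorem4 :
    -- counting: there are `(2k - 1)!!` matchings, and only degrees between `1` and `k` occur
    (∀ k : ℕ, 1 ≤ k →
      (WishartMoments.perfectMatchings k).card = (2 * k - 1)‼ ∧
      ∀ a b : ℕ, WishartMoments.coeff k a b ≠ 0 → (1 ≤ a ∧ a ≤ k) ∧ (1 ≤ b ∧ b ≤ k)) ∧
    -- the tables
    (WishartMoments.coeffMatrix 1 = WishartMoments.table1 ∧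
      WishartMoments.coeffMatrix 2 = WishartMoments.table2 ∧
      WishartMoments.coeffMatrix 3 = WishartMoments.table3 ∧
      WishartMoments.coeffMatrix 4 = WishartMoments.table4 ∧
      WishartMoments.coeffMatrix 5 = WishartMoments.table5 ∧
      WishartMoments.coeffMatrix 6 = WishartMoments.table6 ∧
      WishartMoments.coeffMatrix 7 = WishartMoments.table7 ∧
      WishartMoments.coeffMatrix 8 = WishartMoments.table8 ∧
      WishartMoments.coeffMatrix 9 = WishartMoments.table9 ∧
      WishartMoments.coeffMatrix 10 = WishartMoments.table10) ∧
    -- the moments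
    (∀ {Ω : Type*} [MeasurableSpace Ω] (μ : Measure Ω) [IsProbabilityMeasure μ]
      (m n : ℕ) (σ : ℝ) (W : Fin m → Fin n → Ω → ℝ),
      iIndepFun (fun p : Fin m × Fin n => W p.1 p.2) μ →
      (∀ i j, HasLaw (W i j) (gaussianReal 0 (Real.toNNReal (σ ^ 2))) μ) →
      (∀ k : ℕ, 1 ≤ k →
        Integrable (fun ω => (WishartMoments.wishart W ω ^ k).trace) μ ∧
        ∫ ω, (WishartMoments.wishart W ω ^ k).trace ∂μ =
          σ ^ (2 * k) * ∑ M ∈ WishartMoments.perfectMatchings k,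
            (n : ℝ) ^ WishartMoments.colComponents M * (m : ℝ) ^ WishartMoments.rowComponents M ∧
        ∫ ω, (WishartMoments.wishart W ω ^ k).trace ∂μ =
          σ ^ (2 * k) * ∑ a ∈ Finset.range (k + 1), ∑ b ∈ Finset.range (k + 1),
            (WishartMoments.coeff k a b : ℝ) * (n : ℝ) ^ a * (m : ℝ) ^ b) ∧
      ∫ ω, (WishartMoments.wishart W ω).trace ∂μ = σ ^ 2 * (n * m) ∧
      ∫ ω, (WishartMoments.wishart W ω ^ 2).trace ∂μ = σ ^ 4 * (n * m * (m + n + 1))) := by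
  refine ⟨fun k hk => ⟨WishartMoments.card_perfectMatchings k,
    fun a b => WishartMoments.bounds_of_coeff_ne_zero hk⟩,
    ⟨WishartMoments.coeffMatrix_one, WishartMoments.coeffMatrix_two, WishartMoments.coeffMatrix_three,
      WishartMoments.coeffMatrix_four, WishartMoments.coeffMatrix_five, WishartMoments.coeffMatrix_six,
      WishartMoments.coeffMatrix_seven, WishartMoments.coeffMatrix_eight,
      WishartMoments.coeffMatrix_nine, WishartMoments.coeffMatrix_ten⟩, ?_⟩
  intro Ω _ μ _ m n σ W hind hlaw
  have hmom := fun {k : ℕ} (hk : 1 ≤ k) =>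
    WishartMoments.integral_trace_wishart_pow μ m n σ W hind hlaw hk
  have hcast : ∀ k, ∑ M ∈ WishartMoments.perfectMatchings k,
      (n : ℝ) ^ WishartMoments.colComponents M * (m : ℝ) ^ WishartMoments.rowComponents M =
      ((∑ M ∈ WishartMoments.perfectMatchings k,
        n ^ WishartMoments.colComponents M * m ^ WishartMoments.rowComponents M : ℕ) : ℝ) := by
    intro k
    push_cast
    rfl
  refine ⟨fun k hk => ⟨(hmom hk).1, (hmom hk).2, ?_⟩, ?_, ?_⟩
  · rw [(hmom hk).2, WishartMoments.sum_perfectMatchings_eq _ _ WishartMoments.components_le]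
  · have h := (hmom (k := 1) le_rfl).2
    -- The explicit moments are read off the tables, evaluated at the actual `n` and `m`.
    rw [hcast, ← WishartMoments.evalTable_coeffMatrix le_rfl, WishartMoments.coeffMatrix_one] at h
    simpa [WishartMoments.evalTable, WishartMoments.table1] using h
  · rw [(hmom (k := 2) one_le_two).2, hcast, ← WishartMoments.evalTable_coeffMatrix one_le_two,
      WishartMoments.coeffMatrix_two]
    refine congrArg₂ (· * ·) rfl ?_
    simp [WishartMoments.evalTable, WishartMoments.table2, Fin.sum_univ_two]
    ring
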